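/- **Definitions.** All languages are over finite alphabets. A *finite automaton with nondeterministically translucent letters* (NFAwntl) is $A=(Q,\Sigma,\tau,I,F,\delta)$ with a finite set $Q$ of states, a finite alphabet $\Sigma$, a translucency mapping $\tau:Q\to 2^{\Sigma}$, sets $I,F\subseteq Q$ of initial and final states, and a transition relation $\delta:Q\times\Sigma\to 2^{Q}$ (a letter may be both in $\tau(q)$ and have $\delta(q,a)\neq\emptyset$). A computation step leads from a configuration $q\cdot ubv$ with $u\in\tau(q)^*$, $b\in\Sigma$, $v\in\Sigma^*$ to $p\cdot uv$ for some $p\in\delta(q,b)$. A word $w$ is accepted if from $q_0\cdot w$ for some $q_0\in I$ a configuration $q\cdot r$ with $q\in F$ and $r\in\tau(q)^*$ can be reached in finitely many (possibly zero) steps. $A$ is a DFAwntl if $|I|=1$ and $|\delta(q,a)|\le 1$ for all $q\in Q$, $a\in\Sigma$. A language is *deterministic context-free* if it is accepted, by final state, by a deterministic pushdown automaton, and *deterministic linear* if it is accepted by such an automaton that is one-turn (in no computation is a move decreasing the stack height followed later by a move increasing it). It is *linear context-free* if it is generated by a context-free grammar with at most one nonterminal on the right-hand side of each rule. It is in *2detLIN*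 if it is accepted by a deterministic $5'\to3'$ Watson–Crick finite automaton, i.e. a finite automaton with finitely many transitions $(q,u,v,p)\in Q\times\Sigma^*\times\Sigma^*\times Q$ and steps $(q,uwv)\Rightarrow(p,w)$, in which every configuration has at most one next configuration, and which accepts $w$ if $(q_0,w)\Rightarrow^*(f,\lambda)$ for some final state $f$. Two languages are *letter equivalent* if every word of either one is a permutation of some word of the other one. **Theorem.** (1) The class of languages accepted by NFAwntl and the class of languages accepted by DFAwntl both properly include the class of regular languages. (2) Each of these two classes is incomparable (with respect to inclusion) to each of the following classes: deterministic linear, 2detLIN, linear context-free, deterministic context-free, and context-free languages. (3) There is a language $L$ over $\{a,b,c,d\}$ that is accepted by a DFAwntl, is not context-free, and satisfies $L\cap a^*d^*c^*b^*=\{a^nd^nc^nb^n\mid n\ge 0\}$; the latter language is not context-free. (4) The language $\{a^nb^n\mid n\ge 0\}$ over $\{a,b\}$ belongs to all five classes listed in (2), it has no letter-equivalent regular sublanguage, and it is not accepted by any NFAwntl. -/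

import Mathlib

/-! ### Classes of formal languages -/

/-- A class of formal languages: a property of languages over arbitrary alphabets. Only finite
alphabets are considered when classes are compared. -/
abbrev LanguageClass : Type 1 := (α : Type) → Language α → Prop

namespace LanguageClass

/-- Every language over a finite alphabet that belongs to `C` belongs to `D`. -/
def Included (C D : LanguageClass) : Prop :=
  ∀ (α : Type) [Finite α] (L : Language α), C α L → D α L

/-- `C` is a proper subclass of `D`. -/
def ProperlyIncluded (C D : LanguageClass) : Prop :=
  C.Included D ∧ ¬ D.Included C

/-- Neither of the two classes is included in the other one. -/
def Incomparable (C D : LanguageClass) : Prop :=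
  ¬ C.Included D ∧ ¬ D.Included C

end LanguageClass

/-! ### Finite automata with nondeterministically translucent letters -/

/-- A finite automaton with nondeterministically translucent letters, with set of states `σ`
over the alphabet `α`. The endmarker is implicit: it is the end of the list. No disjointness
between translucent letters and readable letters of a state is required. -/
structure NFAwntl (α σ : Type) where
  /-- The translucency mapping. -/
  translucent : σ → Set α
  /-- The set of initial states. -/
  start : Set σ
  /-- The set of final states. -/
  accept : Set σ
  /-- The transition relation. -/
  step : σ → α → Set σ

namespace NFAwntl

variable {α σ : Type}

/-- One computation step `q · u b v ⊢ p · u v`, where all letters of `u` are translucent for `q`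
and `p ∈ δ(q, b)`. -/
inductive Move (M : NFAwntl α σ) : σ × List α → σ × List α → Prop
  | erase {q p : σ} {u v : List α} {b : α} (hu : ∀ x ∈ u, x ∈ M.translucent q)
      (hp : p ∈ M.step q b) : Move M (q, u ++ b :: v) (p, u ++ v)

/-- A word is accepted if from some initial state one can reach a configuration with a final state
all of whose remaining letters are translucent for that state. -/
def accepts (M : NFAwntl α σ) : Language α :=
  {w | ∃ q₀ ∈ M.start, ∃ q ∈ M.accept, ∃ r : List α,
    Relation.ReflTransGen M.Move (q₀, w) (q, r) ∧ ∀ x ∈ r, x ∈ M.translucent q}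

/-- Exactly one initial state and at most one transition for each state and letter. -/
def IsDeterministic (M : NFAwntl α σ) : Prop :=
  (∃ q₀, M.start = {q₀}) ∧ ∀ q a, (M.step q a).Subsingleton

end NFAwntl

/-! ### Deterministic pushdown automata -/

/-- A deterministic pushdown automaton with states `σ` and stack alphabet `Γ`. A transition
`δ(q, a, Z) = (p, γ)` (where `a` is a letter or `none`, for the empty word) replaces the topmost
stack symbol `Z` by the word `γ`, whose first symbol becomes the topmost one. -/
structure DetPDA (α σ Γ : Type) where
  /-- The partial transition function. -/
  step : σ → Option α → Γ → Option (σ × List Γ)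
  /-- The initial state. -/
  start : σ
  /-- The initial stack symbol. -/
  bottom : Γ
  /-- The set of final states. -/
  accept : Set σ
  /-- If a move without reading is possible, then no reading move is possible. -/
  det : ∀ q Z, step q none Z ≠ none → ∀ a, step q (some a) Z = none

namespace DetPDA

variable {α σ Γ : Type}

/-- One move between configurations (state, remaining input, stack). -/
inductive Move (M : DetPDA α σ Γ) :
    σ × List α × List Γ → σ × List α × List Γ → Prop
  | read {q p : σ} {a : α} {w : List α} {Z : Γ} {γ s : List Γ}
      (h : M.step q (some a) Z = some (p, γ)) : Move M (q, a :: w, Z :: s) (p, w, γ ++ s)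
  | empty {q p : σ} {w : List α} {Z : Γ} {γ s : List Γ}
      (h : M.step q none Z = some (p, γ)) : Move M (q, w, Z :: s) (p, w, γ ++ s)

/-- Reachability between configurations. -/
def Reaches (M : DetPDA α σ Γ) :
    σ × List α × List Γ → σ × List α × List Γ → Prop :=
  Relation.ReflTransGen M.Move

/-- Acceptance by final state after the whole input has been read. -/
def accepts (M : DetPDA α σ Γ) : Language α :=
  {w | ∃ f ∈ M.accept, ∃ s : List Γ, M.Reaches (M.start, w, [M.bottom]) (f, [], s)}

/-- In every computation, after a move that decreases the height of the stack there is no move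
that increases the height of the stack. -/
def IsOneTurn (M : DetPDA α σ Γ) : Prop :=
  ∀ (w : List α) (c₁ c₂ c₃ c₄ : σ × List α × List Γ),
    M.Reaches (M.start, w, [M.bottom]) c₁ → M.Move c₁ c₂ →
    c₂.2.2.length < c₁.2.2.length →
    M.Reaches c₂ c₃ → M.Move c₃ c₄ → c₄.2.2.length ≤ c₃.2.2.length

end DetPDA

/-! ### Two-head automata reading the input from its two ends -/

/-- A sensing `5' → 3'` Watson–Crick finite automaton, that is, a finite automaton whose two heads
read the input from its two extremes until they meet. The transition `(q, u, v, p)` leads from `q`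
to `p`; the left head reads the prefix `u`, the right head the suffix `v` of the unread input. -/
structure TwoHeadFA (α σ : Type) where
  /-- The finitely many transitions. -/
  trans : Finset (σ × List α × List α × σ)
  /-- The initial state. -/
  start : σ
  /-- The set of final states. -/
  accept : Set σ

namespace TwoHeadFA

variable {α σ : Type}

/-- One computation step; a configuration consists of a state and the unread part of the input. -/
inductive Move (M : TwoHeadFA α σ) : σ × List α → σ × List α → Prop
  | read {q p : σ} {u v w : List α} (h : (q, u, v, p) ∈ M.trans) :
      Move M (q, u ++ w ++ v) (p, w)

/-- A word is accepted if it can be read completely so that a final state is reached. -/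
def accepts (M : TwoHeadFA α σ) : Language α :=
  {w | ∃ f ∈ M.accept, Relation.ReflTransGen M.Move (M.start, w) (f, [])}

/-- Every configuration has at most one next configuration. -/
def IsDeterministic (M : TwoHeadFA α σ) : Prop :=
  ∀ c c₁ c₂, M.Move c c₁ → M.Move c c₂ → c₁ = c₂

end TwoHeadFA

/-! ### Linear grammars -/

/-- The right-hand side of each rule contains at most one nonterminal. -/
def ContextFreeGrammar.IsLinear {α : Type} (g : ContextFreeGrammar α) : Prop :=
  ∀ r ∈ g.rules,
    (∃ u : List α, r.output = u.map Symbol.terminal) ∨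
    (∃ (u v : List α) (A : g.NT),
      r.output = u.map Symbol.terminal ++ [Symbol.nonterminal A] ++ v.map Symbol.terminal)

/-! ### The language classes -/

namespace LanguageClass

/-- Languages accepted by NFAwntl. -/
def nfaWNTL : LanguageClass := fun α L =>
  ∃ (σ : Type) (_ : Fintype σ) (M : NFAwntl α σ), M.accepts = L

/-- Languages accepted by DFAwntl. -/
def dfaWNTL : LanguageClass := fun α L =>
  ∃ (σ : Type) (_ : Fintype σ) (M : NFAwntl α σ), M.IsDeterministic ∧ M.accepts = L

/-- Regular languages. -/
def regular : LanguageClass := fun _ L => L.IsRegular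

/-- Context-free languages. -/
def contextFree : LanguageClass := fun _ L => L.IsContextFree

/-- Linear context-free languages. -/
def linear : LanguageClass := fun α L =>
  ∃ g : ContextFreeGrammar α, g.IsLinear ∧ g.language = L

/-- Deterministic context-free languages. -/
def detContextFree : LanguageClass := fun α L =>
  ∃ (σ Γ : Type) (_ : Fintype σ) (_ : Fintype Γ) (M : DetPDA α σ Γ), M.accepts = L

/-- Deterministic linear languages: those accepted by deterministic one-turn pushdown automata. -/
def detLinear : LanguageClass := fun α L =>
  ∃ (σ Γ : Type) (_ : Fintype σ) (_ : Fintype Γ) (M : DetPDA α σ Γ),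
    M.IsOneTurn ∧ M.accepts = L

/-- 2detLIN: languages accepted by deterministic `5' → 3'` Watson–Crick finite automata. -/
def twoDetLIN : LanguageClass := fun α L =>
  ∃ (σ : Type) (_ : Fintype σ) (M : TwoHeadFA α σ), M.IsDeterministic ∧ M.accepts = L

end LanguageClass

/-! ### Letter equivalence and the witness languages -/

/-- Two languages are letter equivalent if each word of either one is a permutation of some word of
the other one. -/
def LetterEquivalent {α : Type} (L₁ L₂ : Language α) : Prop :=
  (∀ x ∈ L₁, ∃ y ∈ L₂, y.Perm x) ∧ (∀ x ∈ L₂, ∃ y ∈ L₁, y.Perm x)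

/-- The language `{aⁿbⁿ | n ≥ 0}`, with letters `a = 0`, `b = 1`. -/
def langAB : Language (Fin 2) :=
  {w | ∃ n : ℕ, w = List.replicate n 0 ++ List.replicate n 1}

/-- The language `a*d*c*b*`, with letters `a = 0`, `b = 1`, `c = 2`, `d = 3`. -/
def langBlocks : Language (Fin 4) :=
  {w | ∃ i j k l : ℕ, w = List.replicate i 0 ++ List.replicate j 3 ++
    List.replicate k 2 ++ List.replicate l 1}

/-- The language `{aⁿdⁿcⁿbⁿ | n ≥ 0}`, with letters `a = 0`, `b = 1`, `c = 2`, `d = 3`. -/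
def langADCB : Language (Fin 4) :=
  {w | ∃ n : ℕ, w = List.replicate n 0 ++ List.replicate n 3 ++
    List.replicate n 2 ++ List.replicate n 1}

/-! Two witnesses separate everything. The language of `cyclicAutomaton`, a DFAwntl that deletes
`a`, `b`, `c`, `d` in rounds, contains every `aⁿdⁿcⁿbⁿ` and only words with equal letter counts. It
is neither regular nor context-free.

To exclude it from all five classes at once, each class is embedded in `BinaryGenerated`:
context-free grammars through suffixes of right-hand sides, deterministic pushdown automata through
the triple construction, two-head automata directly. In place of a pumping lemma,
`BinaryGrammar.Gen.exists_factor` finds replaceable factors of controlled length. By pigeonhole a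
short and a much longer factor come from the same symbol. The longer one misses a letter, so
exchanging the two while keeping the counts equal is impossible (`not_binaryGenerated`).

The other witness is `{aⁿbⁿ}`. An NFAwntl computation can be rearranged to read its letters from
left to right (`NFAwntl.exists_path_of_reaches`), which accepts a permutation of the input. Each
word of `{aⁿbⁿ}` is the only one in the language with its letter counts, so the permutation is the
word itself, and a finite-automaton pigeonhole argument applies (`not_nfaWNTL_langAB`). -/

/-! ### Grammars with rules of bounded shape -/

/-- A grammar with rules `X → λ`, `X → u Y v` and `X → u Y Z`, where `u` and `v` are terminal
words. -/
structure BinaryGrammar (α N : Type) where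
  /-- The rules `X → λ`. -/
  empty : N → Prop
  /-- The rules `X → u Y v`. -/
  lin : N → List α → N → List α → Prop
  /-- The rules `X → u Y Z`. -/
  bin : N → List α → N → N → Prop

namespace BinaryGrammar

variable {α N : Type}

/-- `G.Gen X w`: the terminal word `w` can be derived from `X`. -/
inductive Gen (G : BinaryGrammar α N) : N → List α → Prop
  | empty {X : N} (h : G.empty X) : Gen G X []
  | lin {X Y : N} {u v y : List α} (h : G.lin X u Y v) (hy : Gen G Y y) : Gen G X (u ++ y ++ v)
  | bin {X Y Z : N} {u y z : List α} (h : G.bin X u Y Z) (hy : Gen G Y y) (hz : Gen G Z z) :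
      Gen G X (u ++ y ++ z)

/-- The set `S` is closed under the rules, and the rules for symbols in `S` contain at most `K`
terminals. -/
structure Bounded (G : BinaryGrammar α N) (S : Set N) (K : ℕ) : Prop where
  lin : ∀ X ∈ S, ∀ u Y v, G.lin X u Y v → Y ∈ S ∧ u.length + v.length ≤ K
  bin : ∀ X ∈ S, ∀ u Y Z, G.bin X u Y Z → Y ∈ S ∧ Z ∈ S ∧ u.length ≤ K

/-- A long derived word has a factor of prescribed approximate length that is derived from a single
symbol and can be replaced by every other word derived from that symbol. -/
theorem Gen.exists_factor {G : BinaryGrammar α N} {S : Set N} {K : ℕ} (hG : G.Bounded S K)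
    {n : ℕ} {X : N} {w : List α} (h : G.Gen X w) (hX : X ∈ S) (hn : n ≤ w.length) :
    ∃ Y ∈ S, ∃ u x v : List α, w = u ++ x ++ v ∧ G.Gen Y x ∧ n ≤ x.length ∧
      x.length ≤ 2 * n + K ∧ ∀ x', G.Gen Y x' → G.Gen X (u ++ x' ++ v) := by
  by_cases hw : w.length ≤ 2 * n + K
  · exact ⟨X, hX, [], w, [], by simp, h, hn, hw, by simp⟩
  induction h with
  | empty h => simp at hw
  | @lin X Y a b y hr hy ih =>
    obtain ⟨hY, hab⟩ := hG.lin _ hX _ _ _ hr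
    simp only [List.length_append] at hw hn
    have key : ∃ Z ∈ S, ∃ u x v : List α, y = u ++ x ++ v ∧ G.Gen Z x ∧ n ≤ x.length ∧
        x.length ≤ 2 * n + K ∧ ∀ x', G.Gen Z x' → G.Gen Y (u ++ x' ++ v) := by
      by_cases hy' : y.length ≤ 2 * n + K
      · exact ⟨Y, hY, [], y, [], by simp, hy, by omega, hy', by simp⟩
      · exact ih hY (by omega) hy'
    obtain ⟨Z, hZ, u, x, v, rfl, hx, h1, h2, h3⟩ := key
    exact ⟨Z, hZ, a ++ u, x, v ++ b, by simp, hx, h1, h2, fun x' hx' => by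
      simpa using Gen.lin hr (h3 x' hx')⟩
  | @bin X Y Z a y z hr hy hz ihy ihz =>
    obtain ⟨hY, hZ, ha⟩ := hG.bin _ hX _ _ _ hr
    simp only [List.length_append] at hw hn
    -- Here `2 * n + K < |a| + |y| + |z|` with `|a| ≤ K`, so if `|y| < n` then `|z| > n`, and one of
    -- the two branches is long enough to descend into.
    by_cases hyn : n ≤ y.length
    · have key : ∃ W ∈ S, ∃ u x v : List α, y = u ++ x ++ v ∧ G.Gen W x ∧ n ≤ x.length ∧
          x.length ≤ 2 * n + K ∧ ∀ x', G.Gen W x' → G.Gen Y (u ++ x' ++ v) := by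
        by_cases hy' : y.length ≤ 2 * n + K
        · exact ⟨Y, hY, [], y, [], by simp, hy, by omega, hy', by simp⟩
        · exact ihy hY hyn hy'
      obtain ⟨W, hW, u, x, v, rfl, hx, h1, h2, h3⟩ := key
      exact ⟨W, hW, a ++ u, x, v ++ z, by simp, hx, h1, h2, fun x' hx' => by
        simpa using Gen.bin hr (h3 x' hx') hz⟩
    · have key : ∃ W ∈ S, ∃ u x v : List α, z = u ++ x ++ v ∧ G.Gen W x ∧ n ≤ x.length ∧
          x.length ≤ 2 * n + K ∧ ∀ x', G.Gen W x' → G.Gen Z (u ++ x' ++ v) := by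
        by_cases hz' : z.length ≤ 2 * n + K
        · exact ⟨Z, hZ, [], z, [], by simp, hz, by omega, hz', by simp⟩
        · exact ihz hZ (by omega) hz'
      obtain ⟨W, hW, u, x, v, rfl, hx, h1, h2, h3⟩ := key
      exact ⟨W, hW, a ++ y ++ u, x, v, by simp, hx, h1, h2, fun x' hx' => by
        simpa using Gen.bin hr hy (h3 x' hx')⟩

end BinaryGrammar

/-- The language is generated by a grammar with finitely many symbols and rules of bounded shape. -/
def BinaryGenerated {α : Type} (L : Language α) : Prop :=
  ∃ (N : Type) (G : BinaryGrammar α N) (S : Set N) (K : ℕ) (X : N),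
    S.Finite ∧ G.Bounded S K ∧ X ∈ S ∧ ∀ w, w ∈ L ↔ G.Gen X w

/-! ### Languages between `{aⁿdⁿcⁿbⁿ}` and the words with equally many letters -/

/-- A short factor of `aᵐdᵐcᵐbᵐ` misses one of the letters `a`, `b`. -/
theorem not_mem_of_factor_adcb {m : ℕ} {u x v : List (Fin 4)} (hx : x.length < m)
    (h : List.replicate m 0 ++ List.replicate m 3 ++ List.replicate m 2 ++ List.replicate m 1
      = u ++ x ++ v) : ∃ l : Fin 4, l ∉ x := by
  -- Either `u` covers the whole block of `a`, or `u ++ x` ends within the first `2 * m` letters,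
  -- before the block of `b`.
  by_cases hu : m ≤ u.length
  · refine ⟨0, fun h0 => ?_⟩
    have hd := congrArg (List.drop m) h
    rw [List.append_assoc u, List.drop_append_of_le_length hu] at hd
    have : (0 : Fin 4) ∈ List.drop m u ++ (x ++ v) := by simp [h0]
    rw [← hd] at this
    simp [List.mem_replicate] at this
  · refine ⟨1, fun h1 => ?_⟩
    have ht := congrArg (List.take (2 * m)) h
    have : (1 : Fin 4) ∈ List.take (2 * m) (u ++ x ++ v) := by
      rw [List.take_append, List.take_of_length_le (by simp; omega)]
      simp [h1]
    rw [← ht, List.append_assoc, List.take_append_of_le_length (by simp; omega)] at this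
    have := List.mem_of_mem_take this
    simp [List.mem_replicate] at this

/-- A language that contains all words `aⁿdⁿcⁿbⁿ` and only words with equally many occurrences of
all letters is not generated by a grammar with finitely many rules. -/
theorem not_binaryGenerated {L : Language (Fin 4)} (hlow : langADCB ≤ L)
    (hup : ∀ w ∈ L, ∃ c, ∀ l, w.count l = c) : ¬ BinaryGenerated L := by
  rintro ⟨N, G, S, K, X, hS, hG, hX, hL⟩
  have key : ∀ n : ℕ, ∃ Y : S, ∃ u x v : List (Fin 4), (u ++ x ++ v ∈ L) ∧ G.Gen Y x ∧
      n ≤ x.length ∧ x.length ≤ 2 * n + K ∧ (∃ l, l ∉ x) ∧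
      ∀ x', G.Gen Y x' → u ++ x' ++ v ∈ L := by
    intro n
    -- The blocks are one letter longer than the largest possible factor, so the factor misses a
    -- letter.
    have hw := hlow ⟨2 * n + K + 1, rfl⟩
    obtain ⟨Y, hY, u, x, v, he, hx, h1, h2, h3⟩ :=
      ((hL _).1 hw).exists_factor hG (n := n) hX (by simp; omega)
    exact ⟨⟨Y, hY⟩, u, x, v, he ▸ hw, hx, h1, h2, not_mem_of_factor_adcb (by omega) he,
      fun x' hx' => (hL _).2 (h3 x' hx')⟩
  choose Y u x v hw hx h1 h2 hmiss h3 using key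
  have := hS.to_subtype
  obtain ⟨Z, hZ⟩ := Finite.exists_infinite_fiber Y
  have hinf : (Y ⁻¹' {Z}).Infinite := Set.infinite_coe_iff.1 hZ
  obtain ⟨n, hn⟩ := hinf.nonempty
  -- This makes `x m` strictly longer than `x n`.
  obtain ⟨m, hm, hnm⟩ := hinf.exists_gt (2 * n + K)
  have hYm : Y m = Y n := by
    rw [Set.mem_preimage, Set.mem_singleton_iff] at hn hm
    rw [hn, hm]
  obtain ⟨c, hc⟩ := hup _ (hw n)
  obtain ⟨d, hd⟩ := hup _ (h3 n (x m) (hYm ▸ hx m))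
  obtain ⟨l, hl⟩ := hmiss m
  -- Replacing `x n` by `x m` changes every letter count by the same amount. The count of the letter
  -- `l` missing from `x m` cannot increase, so no count does, which contradicts the lengths.
  have hsub : (x m).Subperm (x n) := by
    rw [List.subperm_ext_iff]
    intro k _
    have e1 := hc k
    have e2 := hd k
    have e3 := hc l
    have e4 := hd l
    simp only [List.count_append] at e1 e2 e3 e4
    rw [List.count_eq_zero.2 hl] at e4
    omega
  have := hsub.length_le
  have := h1 m
  have := h2 n
  omega

/-! ### Context-free languages -/

namespace ContextFreeGrammar

variable {α : Type}

/-- The grammar whose symbols are the sentential forms of `g`. -/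
def toBinary (g : ContextFreeGrammar α) : BinaryGrammar α (List (Symbol α g.NT)) where
  empty s := s = []
  lin s u t v := ∃ a, s = Symbol.terminal a :: t ∧ u = [a] ∧ v = []
  bin s u t s' := u = [] ∧ ∃ r ∈ g.rules, s = Symbol.nonterminal r.input :: s' ∧ t = r.output

variable {g : ContextFreeGrammar α}

theorem toBinary_gen_append {s t : List (Symbol α g.NT)} {w : List α}
    (h : g.toBinary.Gen (s ++ t) w) :
    ∃ x y, w = x ++ y ∧ g.toBinary.Gen s x ∧ g.toBinary.Gen t y := by
  induction s generalizing w with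
  | nil => exact ⟨[], w, rfl, .empty rfl, h⟩
  | cons Z s ih =>
    cases h with
    | empty h => cases h
    | lin hr hy =>
      obtain ⟨a, he, rfl, rfl⟩ := hr
      obtain ⟨rfl, rfl⟩ := List.cons.inj he
      obtain ⟨x, y, rfl, hx, hy⟩ := ih hy
      exact ⟨[a] ++ x ++ [], y, by simp, .lin ⟨a, rfl, rfl, rfl⟩ hx, hy⟩
    | bin hr hy hz =>
      obtain ⟨rfl, r, hr, he, rfl⟩ := hr
      obtain ⟨rfl, rfl⟩ := List.cons.inj he
      obtain ⟨x, y, rfl, hx, hy'⟩ := ih hz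
      exact ⟨[] ++ _ ++ x, y, by simp, .bin ⟨rfl, r, hr, rfl, rfl⟩ hy hx, hy'⟩

theorem toBinary_gen_of_produces {s t : List (Symbol α g.NT)} {w : List α}
    (h : g.Produces s t) (ht : g.toBinary.Gen t w) : g.toBinary.Gen s w := by
  obtain ⟨r, hr, h⟩ := h
  induction h generalizing w with
  | head s =>
    obtain ⟨x, y, rfl, hx, hy⟩ := toBinary_gen_append ht
    exact .bin (u := []) ⟨rfl, r, hr, rfl, rfl⟩ hx hy
  | cons Z h ih =>
    cases ht with
    | empty h => cases h
    | lin hr hy =>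
      obtain ⟨a, he, rfl, rfl⟩ := hr
      obtain ⟨rfl, rfl⟩ := List.cons.inj he
      exact .lin ⟨a, rfl, rfl, rfl⟩ (ih hy)
    | bin hr' hy hz =>
      obtain ⟨rfl, r', hr', he, rfl⟩ := hr'
      obtain ⟨rfl, rfl⟩ := List.cons.inj he
      exact .bin ⟨rfl, r', hr', rfl, rfl⟩ hy (ih hz)

theorem toBinary_gen_map_terminal (w : List α) : g.toBinary.Gen (w.map Symbol.terminal) w := by
  induction w with
  | nil => exact .empty rfl
  | cons a w ih =>
    simpa using BinaryGrammar.Gen.lin (v := [])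
      (⟨a, rfl, rfl, rfl⟩ : g.toBinary.lin (Symbol.terminal a :: _) _ _ _) ih

theorem toBinary_gen_iff {s : List (Symbol α g.NT)} {w : List α} :
    g.toBinary.Gen s w ↔ g.Derives s (w.map Symbol.terminal) := by
  constructor
  · intro h
    induction h with
    | empty h => cases h; rfl
    | lin hr hy ih =>
      obtain ⟨a, rfl, rfl, rfl⟩ := hr
      simpa using ih.append_left [Symbol.terminal a]
    | @bin X Y Z u y z hr hy hz ihy ihz =>
      obtain ⟨rfl, r, hr, rfl, rfl⟩ := hr
      have h1 : g.Produces (Symbol.nonterminal r.input :: Z) (r.output ++ Z) := ⟨r, hr, .head Z⟩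
      simpa using h1.trans_derives ((ihy.append_right Z).trans (ihz.append_left _))
  · intro h
    induction h using Relation.ReflTransGen.head_induction_on with
    | refl => exact toBinary_gen_map_terminal w
    | head h _ ih => exact toBinary_gen_of_produces h ih

end ContextFreeGrammar

theorem finite_setOf_suffix {β : Type} {T : Set (List β)} (hT : T.Finite) :
    {s | ∃ t ∈ T, s <:+ t}.Finite := by
  refine (hT.biUnion fun t _ => t.tails.finite_toSet).subset ?_
  rintro s ⟨t, ht, hs⟩
  exact Set.mem_biUnion ht (by simpa using hs)

/-- A rule of `toBinary` leads only to a tail of the current form or to a right-hand side of `g`.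
The suffixes of the right-hand sides and of the initial form are therefore a finite closed set of
symbols. -/
theorem Language.IsContextFree.binaryGenerated {α : Type} {L : Language α}
    (hL : L.IsContextFree) : BinaryGenerated L := by
  obtain ⟨g, rfl⟩ := hL
  refine ⟨_, g.toBinary,
    {s | ∃ t ∈ insert [Symbol.nonterminal g.initial] (ContextFreeRule.output '' (g.rules : Set _)),
      s <:+ t}, 1, [Symbol.nonterminal g.initial],
    finite_setOf_suffix ((g.rules.finite_toSet.image _).insert _), ⟨?_, ?_⟩,
    ⟨_, Set.mem_insert _ _, List.suffix_refl _⟩, fun w => g.toBinary_gen_iff.symm⟩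
  · rintro _ ⟨t, ht, hs⟩ _ Y _ ⟨a, rfl, rfl, rfl⟩
    exact ⟨⟨t, ht, (List.suffix_cons _ _).trans hs⟩, by simp⟩
  · rintro _ ⟨t, ht, hs⟩ _ Y Z ⟨rfl, r, hr, rfl, rfl⟩
    exact ⟨⟨_, .inr ⟨r, hr, rfl⟩, List.suffix_refl _⟩, ⟨t, ht, (List.suffix_cons _ _).trans hs⟩,
      by simp⟩

/-! ### Two-head automata -/

namespace TwoHeadFA

variable {α σ : Type}

/-- The grammar with a rule `q → u p v` for each transition `(q, u, v, p)`. -/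
def toBinary (M : TwoHeadFA α σ) : BinaryGrammar α σ where
  empty q := q ∈ M.accept
  lin q u p v := (q, u, v, p) ∈ M.trans
  bin _ _ _ _ := False

theorem toBinary_gen_iff {M : TwoHeadFA α σ} {q : σ} {w : List α} :
    M.toBinary.Gen q w ↔ ∃ f ∈ M.accept, Relation.ReflTransGen M.Move (q, w) (f, []) := by
  constructor
  · intro h
    induction h with
    | empty h => exact ⟨_, h, .refl⟩
    | lin hr hy ih =>
      obtain ⟨f, hf, h⟩ := ih
      exact ⟨f, hf, .head (.read hr) h⟩
    | bin h => exact h.elim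
  · rintro ⟨f, hf, h⟩
    generalize hc : (q, w) = c at h
    induction h using Relation.ReflTransGen.head_induction_on generalizing q w with
    | refl => cases hc; exact .empty hf
    | head h _ ih =>
      subst hc
      cases h with
      | read h => exact .lin h (ih rfl)

end TwoHeadFA

theorem LanguageClass.twoDetLIN.binaryGenerated {α : Type} {L : Language α}
    (hL : LanguageClass.twoDetLIN α L) : BinaryGenerated L := by
  obtain ⟨σ, _, M, -, rfl⟩ := hL
  refine ⟨σ, M.toBinary, Set.univ, M.trans.sup fun t => t.2.1.length + t.2.2.1.length, M.start,
    Set.finite_univ, ⟨fun X _ u Y v h => ⟨trivial, ?_⟩, fun _ _ _ _ _ h => h.elim⟩, trivial,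
    fun w => M.toBinary_gen_iff.symm⟩
  exact Finset.le_sup (f := fun t : σ × List α × List α × σ => t.2.1.length + t.2.2.1.length) h

/-! ### Deterministic pushdown automata -/

namespace DetPDA

variable {α σ Γ : Type}

theorem Move.of_step {M : DetPDA α σ Γ} {q p : σ} {o : Option α} {Z : Γ} {γ : List Γ}
    (h : M.step q o Z = some (p, γ)) (w : List α) (s : List Γ) :
    M.Move (q, o.toList ++ w, Z :: s) (p, w, γ ++ s) := by
  cases o with
  | none => exact .empty h
  | some a => exact .read h

/-- The triple construction. The symbol `(q, s, some t)` generates the words that lead from `q`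
to `t` while the stack contents `s` are removed, `(q, s, none)` those that lead from `q` with stack
contents `s` to acceptance. -/
def toBinary (M : DetPDA α σ Γ) : BinaryGrammar α (σ × List Γ × Option σ) where
  empty X := (X.2.1 = [] ∧ X.2.2 = some X.1) ∨ (X.1 ∈ M.accept ∧ X.2.2 = none)
  lin X u Y v := ∃ q p o Z γ s, M.step q o Z = some (p, γ) ∧ X = (q, Z :: s, none) ∧
    u = o.toList ∧ Y = (p, γ, none) ∧ v = []
  bin X u Y W := ∃ q p o Z γ s r t, M.step q o Z = some (p, γ) ∧ X = (q, Z :: s, t) ∧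
    u = o.toList ∧ Y = (p, γ, some r) ∧ W = (r, s, t)

variable {M : DetPDA α σ Γ}

/-- The unread input `z` and the untouched lower stack `s'` are arbitrary so that the two
computations of a `bin` rule can be concatenated. -/
theorem reaches_of_toBinary_gen {X : σ × List Γ × Option σ} {w : List α}
    (h : M.toBinary.Gen X w) (z : List α) (s' : List Γ) :
    ∃ f s'', M.Reaches (X.1, w ++ z, X.2.1 ++ s') (f, z, s'') ∧
      ((X.2.2 = none ∧ f ∈ M.accept) ∨ (X.2.2 = some f ∧ s'' = s')) := by
  induction h generalizing z s' with
  | @empty X h =>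
    refine ⟨X.1, X.2.1 ++ s', .refl, ?_⟩
    rcases h with ⟨h1, h2⟩ | ⟨h1, h2⟩
    · exact .inr ⟨h2, by simp [h1]⟩
    · exact .inl ⟨h2, h1⟩
  | @lin X Y u v y hr hy ih =>
    obtain ⟨q, p, o, Z, γ, s, hs, rfl, rfl, rfl, rfl⟩ := hr
    obtain ⟨f, s'', h, hf⟩ := ih z (s ++ s')
    refine ⟨f, s'', ?_, .inl ⟨rfl, by simpa using hf⟩⟩
    simpa [Reaches] using Relation.ReflTransGen.head (Move.of_step hs (y ++ z) (s ++ s')) h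
  | @bin X Y W u y x hr hy hx ihy ihx =>
    obtain ⟨q, p, o, Z, γ, s, r, t, hs, rfl, rfl, rfl, rfl⟩ := hr
    obtain ⟨f₁, s₁, h₁, hf₁⟩ := ihy (x ++ z) (s ++ s')
    obtain ⟨rfl, rfl⟩ : r = f₁ ∧ s₁ = s ++ s' := by simpa using hf₁
    obtain ⟨f, s'', h, hf⟩ := ihx z s'
    refine ⟨f, s'', ?_, hf⟩
    simpa [Reaches] using Relation.ReflTransGen.head (Move.of_step hs (y ++ (x ++ z)) (s ++ s'))
      (h₁.trans h)

/-- Either acceptance occurs before `t` is exposed, or the word splits at the moment when `s` has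
been removed. -/
theorem toBinary_gen_append {q : σ} {s t : List Γ} {w : List α}
    (h : M.toBinary.Gen (q, s ++ t, none) w) :
    M.toBinary.Gen (q, s, none) w ∨ ∃ r x y, w = x ++ y ∧ M.toBinary.Gen (q, s, some r) x ∧
      M.toBinary.Gen (r, t, none) y := by
  induction s generalizing q w with
  | nil => exact .inr ⟨q, [], w, rfl, .empty (.inl ⟨rfl, rfl⟩), h⟩
  | cons Z s ih =>
    cases h with
    | empty h => exact .inl (.empty (.inr (by simpa [toBinary] using h)))
    | lin hr hy =>
      obtain ⟨q', p, o, Z', γ, s', hs, he, rfl, rfl, rfl⟩ := hr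
      cases he
      exact .inl (.lin ⟨q, p, o, Z, γ, s, hs, rfl, rfl, rfl, rfl⟩ hy)
    | bin hr hy hz =>
      obtain ⟨q', p, o, Z', γ, s', r, t', hs, he, rfl, rfl, rfl⟩ := hr
      cases he
      rcases ih hz with h | ⟨r', x, y, rfl, hx, hy'⟩
      · exact .inl (.bin ⟨q, p, o, Z, γ, s, r, none, hs, rfl, rfl, rfl, rfl⟩ hy h)
      · exact .inr ⟨r', _, y, (List.append_assoc _ _ _).symm,
          .bin ⟨q, p, o, Z, γ, s, r, some r', hs, rfl, rfl, rfl, rfl⟩ hy hx, hy'⟩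

theorem toBinary_gen_of_step {q p : σ} {o : Option α} {Z : Γ} {γ s : List Γ} {w : List α}
    (hs : M.step q o Z = some (p, γ)) (h : M.toBinary.Gen (p, γ ++ s, none) w) :
    M.toBinary.Gen (q, Z :: s, none) (o.toList ++ w) := by
  rcases toBinary_gen_append h with h | ⟨r, x, y, rfl, hx, hy⟩
  · simpa using BinaryGrammar.Gen.lin (v := [])
      (⟨q, p, o, Z, γ, s, hs, rfl, rfl, rfl, rfl⟩ : M.toBinary.lin _ _ _ _) h
  · simpa using BinaryGrammar.Gen.bin
      (⟨q, p, o, Z, γ, s, r, none, hs, rfl, rfl, rfl, rfl⟩ : M.toBinary.bin _ _ _ _) hx hy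

theorem toBinary_gen_of_reaches {c : σ × List α × List Γ} {f : σ} {s : List Γ}
    (hf : f ∈ M.accept) (h : M.Reaches c (f, [], s)) :
    M.toBinary.Gen (c.1, c.2.2, none) c.2.1 := by
  induction h using Relation.ReflTransGen.head_induction_on with
  | refl => exact .empty (.inr ⟨hf, rfl⟩)
  | head h _ ih =>
    cases h with
    | read h => exact toBinary_gen_of_step h ih
    | empty h => exact toBinary_gen_of_step h ih

theorem mem_accepts_iff_toBinary_gen {w : List α} :
    w ∈ M.accepts ↔ M.toBinary.Gen (M.start, [M.bottom], none) w := by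
  constructor
  · rintro ⟨f, hf, s, h⟩
    exact toBinary_gen_of_reaches hf h
  · intro h
    obtain ⟨f, s, hr, hf⟩ := reaches_of_toBinary_gen h [] []
    exact ⟨f, by simpa using hf, s, by simpa using hr⟩

end DetPDA

/-- Only suffixes of the initial stack and of words pushed by a transition occur in the triples.
They are finitely many because states, letters and stack symbols are. -/
theorem LanguageClass.detContextFree.binaryGenerated {α : Type} [Finite α] {L : Language α}
    (hL : LanguageClass.detContextFree α L) : BinaryGenerated L := by
  obtain ⟨σ, Γ, _, _, M, rfl⟩ := hL
  let T : Set (List Γ) := insert [M.bottom]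
    -- Undefined transitions contribute the harmless word `[]`.
    (Set.range fun x : σ × Option α × Γ => ((M.step x.1 x.2.1 x.2.2).map Prod.snd).getD [])
  have hT : T.Finite := (Set.finite_range _).insert _
  have hstep : ∀ {q o Z p γ}, M.step q o Z = some (p, γ) → γ ∈ T := fun {q o Z p γ} h =>
    .inr ⟨(q, o, Z), by simp [h]⟩
  have hlen : ∀ o : Option α, o.toList.length ≤ 1 := by rintro (_ | _) <;> simp
  refine ⟨_, M.toBinary, {X | X.2.1 ∈ {s | ∃ t ∈ T, s <:+ t}}, 1, (M.start, [M.bottom], none),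
    ?_, ⟨?_, ?_⟩, ⟨_, .inl rfl, List.suffix_refl _⟩, fun w => M.mem_accepts_iff_toBinary_gen⟩
  · refine (Set.finite_univ.prod ((finite_setOf_suffix hT).prod Set.finite_univ)).subset ?_
    exact fun X hX => ⟨trivial, hX, trivial⟩
  · rintro _ - _ _ _ ⟨q, p, o, Z, γ, s, hs, rfl, rfl, rfl, rfl⟩
    exact ⟨⟨γ, hstep hs, List.suffix_refl _⟩, hlen o⟩
  · rintro _ ⟨t', ht', hX⟩ _ _ _ ⟨q, p, o, Z, γ, s, r, t, hs, rfl, rfl, rfl, rfl⟩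
    exact ⟨⟨γ, hstep hs, List.suffix_refl _⟩, ⟨t', ht', (List.suffix_cons _ _).trans hX⟩, hlen o⟩


/-! ### Regular languages -/

/-- A language that contains all words `aⁿdⁿcⁿbⁿ` and only words with equally many occurrences of
all letters is not regular. -/
theorem not_isRegular_of_langADCB_le {L : Language (Fin 4)} (hlow : langADCB ≤ L)
    (hup : ∀ w ∈ L, ∃ c, ∀ l, w.count l = c) : ¬ L.IsRegular := by
  rintro ⟨σ, _, D, rfl⟩
  -- Two prefixes `aⁿ` and `aᵐ` lead to the same state, so `aᵐdⁿcⁿbⁿ` is accepted as well, with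
  -- unequal counts of `a` and `b`.
  obtain ⟨n, m, hnm, h⟩ := Finite.exists_ne_map_eq_of_infinite
    fun n : ℕ => D.eval (List.replicate n 0)
  have hn : List.replicate n 0 ++ (List.replicate n 3 ++ List.replicate n 2 ++
      List.replicate n 1) ∈ D.accepts := by
    have := hlow ⟨n, rfl⟩
    rwa [List.append_assoc, List.append_assoc, ← List.append_assoc (List.replicate n 3)] at this
  have hm : List.replicate m 0 ++ (List.replicate n 3 ++ List.replicate n 2 ++
      List.replicate n 1) ∈ D.accepts := by
    rw [DFA.mem_accepts, DFA.eval, DFA.evalFrom_of_append] at hn ⊢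
    exact (congrArg (fun s => D.evalFrom s _ ∈ D.accept) h).mp hn
  obtain ⟨c, hc⟩ := hup _ hm
  have h0 := hc 0
  have h1 := hc 1
  simp [List.count_replicate] at h0 h1
  omega

theorem LanguageClass.dfaWNTL.nfaWNTL {α : Type} {L : Language α}
    (h : LanguageClass.dfaWNTL α L) : LanguageClass.nfaWNTL α L := by
  obtain ⟨σ, hσ, M, -, hM⟩ := h
  exact ⟨σ, hσ, M, hM⟩

/-- A deterministic finite automaton as an automaton without translucent letters. -/
def DFA.toNFAwntl {α σ : Type} (D : DFA α σ) : NFAwntl α σ where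
  translucent _ := ∅
  start := {D.start}
  accept := D.accept
  step q a := {D.step q a}

theorem DFA.toNFAwntl_reaches_iff {α σ : Type} (D : DFA α σ) {q : σ} {w : List α} :
    (∃ f ∈ D.accept, Relation.ReflTransGen D.toNFAwntl.Move (q, w) (f, [])) ↔
      D.evalFrom q w ∈ D.accept := by
  constructor
  · rintro ⟨f, hf, h⟩
    generalize hc : (q, w) = c at h
    induction h using Relation.ReflTransGen.head_induction_on generalizing q w with
    | refl => cases hc; exact hf
    | head h _ ih =>
      subst hc
      cases h with
      | @erase _ p u v b hu hp =>
        obtain rfl : u = [] := List.eq_nil_iff_forall_not_mem.2 hu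
        cases hp
        simpa using ih rfl
  · intro h
    induction w generalizing q with
    | nil => exact ⟨q, h, .refl⟩
    | cons a w ih =>
      obtain ⟨f, hf, hr⟩ := ih (q := D.step q a) (by simpa using h)
      exact ⟨f, hf, .head (NFAwntl.Move.erase (M := D.toNFAwntl) (u := []) (by simp) rfl) hr⟩

theorem Language.IsRegular.dfaWNTL {α : Type} {L : Language α} (h : L.IsRegular) :
    LanguageClass.dfaWNTL α L := by
  obtain ⟨σ, hσ, D, rfl⟩ := h
  refine ⟨σ, hσ, D.toNFAwntl, ⟨⟨_, rfl⟩, fun q a => Set.subsingleton_singleton⟩, ?_⟩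
  ext w
  rw [DFA.mem_accepts, DFA.eval, ← DFA.toNFAwntl_reaches_iff]
  constructor
  · rintro ⟨_, rfl, f, hf, r, hr, hτ⟩
    obtain rfl : r = [] := List.eq_nil_iff_forall_not_mem.2 hτ
    exact ⟨f, hf, hr⟩
  · rintro ⟨f, hf, hr⟩
    exact ⟨_, rfl, f, hf, [], hr, by simp⟩

/-! ### A DFAwntl for a language that is not context-free -/

/-- The automaton that cyclically deletes the letters `a`, `b`, `c`, `d`, where `a` has to be the
first letter of the word, and the other letters may be taken from anywhere. -/
def cyclicAutomaton : NFAwntl (Fin 4) (Fin 4) where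
  translucent q := {_x | q ≠ 0}
  start := {0}
  accept := {0}
  step q x := {p | x = q ∧ p = q + 1}

theorem cyclicAutomaton_dfaWNTL : LanguageClass.dfaWNTL (Fin 4) cyclicAutomaton.accepts := by
  refine ⟨Fin 4, inferInstance, cyclicAutomaton, ⟨⟨0, rfl⟩, ?_⟩, rfl⟩
  rintro q a p ⟨-, rfl⟩ p' ⟨-, rfl⟩
  rfl

/-- In state `q` the letters below `q` have already been deleted in the current round. Adding one
occurrence of each back balances the counts. -/
theorem cyclicAutomaton_count {c : Fin 4 × List (Fin 4)}
    (h : Relation.ReflTransGen cyclicAutomaton.Move c (0, [])) :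
    ∃ k, ∀ l : Fin 4, c.2.count l + (if l < c.1 then 1 else 0) = k := by
  induction h using Relation.ReflTransGen.head_induction_on with
  | refl => exact ⟨0, by simp⟩
  | head h _ ih =>
    obtain ⟨k, hk⟩ := ih
    cases h with
    | @erase q p u v b hu hp =>
      obtain ⟨rfl, rfl⟩ := hp
      have h0 := hk 0
      have h1 := hk 1
      have h2 := hk 2
      have h3 := hk 3
      fin_cases b
      · exact ⟨k, fun l => by fin_cases l <;> simp at * <;> omega⟩
      · exact ⟨k, fun l => by fin_cases l <;> simp at * <;> omega⟩
      · exact ⟨k, fun l => by fin_cases l <;> simp at * <;> omega⟩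
      -- Deleting `d` closes a round: the state wraps around to `0`, and going backwards the balance
      -- grows by one.
      · exact ⟨k + 1, fun l => by fin_cases l <;> simp at * <;> omega⟩

theorem count_eq_of_mem_cyclicAutomaton {w : List (Fin 4)} (h : w ∈ cyclicAutomaton.accepts) :
    ∃ k, ∀ l, w.count l = k := by
  obtain ⟨_, rfl, _, rfl, r, hr, hτ⟩ := h
  obtain rfl : r = [] := List.eq_nil_iff_forall_not_mem.2 fun x hx => hτ x hx rfl
  obtain ⟨k, hk⟩ := cyclicAutomaton_count hr
  exact ⟨k, fun l => by simpa using hk l⟩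

theorem langADCB_le_cyclicAutomaton : langADCB ≤ cyclicAutomaton.accepts := by
  rintro _ ⟨n, rfl⟩
  refine ⟨0, rfl, 0, rfl, [], ?_, by simp⟩
  induction n with
  | zero => exact .refl
  | succ n ih =>
    have move : ∀ (q : Fin 4) (u v : List (Fin 4)), (∀ x ∈ u, q ≠ 0) →
        cyclicAutomaton.Move (q, u ++ q :: v) (q + 1, u ++ v) :=
      fun q u v hu => .erase hu ⟨rfl, rfl⟩
    have ha := move 0 [] (List.replicate n 0 ++ List.replicate (n + 1) 3 ++
      List.replicate (n + 1) 2 ++ List.replicate (n + 1) 1) (by simp)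
    have hb := move 1 (List.replicate n 0 ++ List.replicate (n + 1) 3 ++
      List.replicate (n + 1) 2) (List.replicate n 1) (by simp)
    have hc := move 2 (List.replicate n 0 ++ List.replicate (n + 1) 3)
      (List.replicate n 2 ++ List.replicate n 1) (by simp)
    have hd := move 3 (List.replicate n 0)
      (List.replicate n 3 ++ (List.replicate n 2 ++ List.replicate n 1)) (by simp)
    simp only [List.replicate_succ, List.append_assoc, List.cons_append, List.nil_append]
      at ha hb hc hd ih ⊢
    exact .head ha (.head hb (.head hc (.head hd ih)))

theorem cyclicAutomaton_inf_langBlocks : cyclicAutomaton.accepts ⊓ langBlocks = langADCB := by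
  apply le_antisymm
  · rintro _ ⟨hw, i, j, k, l, rfl⟩
    obtain ⟨c, hc⟩ := count_eq_of_mem_cyclicAutomaton hw
    have h0 := hc 0
    have h1 := hc 1
    have h2 := hc 2
    have h3 := hc 3
    simp [List.count_replicate] at h0 h1 h2 h3
    subst h0 h1 h2 h3
    exact ⟨_, rfl⟩
  · exact le_inf langADCB_le_cyclicAutomaton fun w ⟨n, hn⟩ => ⟨n, n, n, n, hn⟩

theorem not_isContextFree_langADCB : ¬ langADCB.IsContextFree := fun h => by
  refine not_binaryGenerated le_rfl ?_ h.binaryGenerated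
  exact fun w hw => count_eq_of_mem_cyclicAutomaton (langADCB_le_cyclicAutomaton hw)

theorem not_binaryGenerated_cyclicAutomaton : ¬ BinaryGenerated cyclicAutomaton.accepts :=
  not_binaryGenerated langADCB_le_cyclicAutomaton fun _ => count_eq_of_mem_cyclicAutomaton

/-! ### The language `{aⁿbⁿ}` is not accepted by any NFAwntl -/

theorem replicate_append_mem_langAB_iff {n m : ℕ} :
    List.replicate n 0 ++ List.replicate m 1 ∈ langAB ↔ n = m := by
  constructor
  · rintro ⟨k, hk⟩
    have h0 := congrArg (List.count 0) hk
    have h1 := congrArg (List.count 1) hk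
    simp [List.count_replicate] at h0 h1
    omega
  · rintro rfl
    exact ⟨n, rfl⟩

/-- The number of `a` determines a word of `langAB`. Hence rearranged computations accept the
original word, and a letter-equivalent sublanguage must be everything. -/
theorem eq_of_perm_of_mem_langAB {n : ℕ} {w : List (Fin 2)} (hw : w ∈ langAB)
    (h : w.Perm (List.replicate n 0 ++ List.replicate n 1)) :
    w = List.replicate n 0 ++ List.replicate n 1 := by
  obtain ⟨m, rfl⟩ := hw
  have := h.count_eq 0
  simp [List.count_replicate] at this
  rw [this]

namespace NFAwntl

variable {α σ : Type} {M : NFAwntl α σ}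

/-- A path labelled with a word in the transition graph. -/
inductive Path (M : NFAwntl α σ) : σ → List α → σ → Prop
  | nil (q : σ) : Path M q [] q
  | cons {q p r : σ} {a : α} {w : List α} (h : p ∈ M.step q a) (hp : Path M p w r) :
      Path M q (a :: w) r

theorem Path.split {x y : List α} {q r : σ} (h : M.Path q (x ++ y) r) :
    ∃ p, M.Path q x p ∧ M.Path p y r := by
  induction x generalizing q with
  | nil => exact ⟨q, .nil q, h⟩
  | cons a x ih =>
    cases h with
    | cons h hp =>
      obtain ⟨p, h1, h2⟩ := ih hp
      exact ⟨p, .cons h h1, h2⟩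

/-- Along a path the letters can be read from left to right. -/
theorem Path.reaches {x : List α} {q p : σ} (h : M.Path q x p) (r : List α) :
    Relation.ReflTransGen M.Move (q, x ++ r) (p, r) := by
  induction h with
  | nil q => exact .refl
  | cons h _ ih => exact .head (Move.erase (u := []) (by simp) h) ih

/-- Every computation can be rearranged to one that reads from left to right. -/
theorem exists_path_of_reaches {c d : σ × List α} (h : Relation.ReflTransGen M.Move c d) :
    ∃ x, M.Path c.1 x d.1 ∧ (x ++ d.2).Perm c.2 := by
  induction h using Relation.ReflTransGen.head_induction_on with
  | refl => exact ⟨[], .nil _, by simp⟩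
  | head h _ ih =>
    obtain ⟨x, hx, hp⟩ := ih
    cases h with
    | @erase q p u v b hu hs =>
      exact ⟨b :: x, .cons hs hx, (hp.cons b).trans List.perm_middle.symm⟩

end NFAwntl

/-- For `n > 0`, a left-to-right accepting computation on `aⁿbⁿ` must read all of `aⁿ`, since
otherwise every `b` remains at the end and is translucent. Two exponents with the same state after
the block of `a` then allow the blocks to be mixed. -/
theorem not_nfaWNTL_langAB : ¬ LanguageClass.nfaWNTL (Fin 2) langAB := by
  rintro ⟨σ, _, M, hM⟩
  have key : ∀ n : ℕ, ∃ p : σ, ∃ q₀ ∈ M.start, M.Path q₀ (List.replicate n 0) p ∧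
      (n = 0 ∨ ∃ q ∈ M.accept, ∃ x r, List.replicate n 1 = x ++ r ∧ M.Path p x q ∧
        ∀ y ∈ r, y ∈ M.translucent q) := by
    intro n
    have hn : List.replicate n 0 ++ List.replicate n 1 ∈ M.accepts :=
      hM ▸ replicate_append_mem_langAB_iff.2 rfl
    obtain ⟨q₀, hq₀, q, hq, r, hr, hτ⟩ := hn
    obtain ⟨x, hx, hp⟩ := NFAwntl.exists_path_of_reaches hr
    have hacc : x ++ r ∈ langAB := hM ▸ ⟨q₀, hq₀, q, hq, r, hx.reaches r, hτ⟩
    have he : x ++ r = List.replicate n 0 ++ List.replicate n 1 :=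
      eq_of_perm_of_mem_langAB hacc hp
    rcases List.append_eq_append_iff.1 he with ⟨t, hx', hr'⟩ | ⟨t, rfl, hr'⟩
    · rcases Nat.eq_zero_or_pos n with rfl | hpos
      · exact ⟨q₀, q₀, hq₀, .nil _, .inl rfl⟩
      · exfalso
        have hb : (1 : Fin 2) ∈ M.translucent q :=
          hτ 1 (by rw [hr']; simp [List.mem_replicate]; omega)
        -- A translucent `b` may be appended without affecting acceptance, which gives `aⁿbⁿ⁺¹`.
        have hacc' : (x ++ r) ++ [1] ∈ langAB := hM ▸ ⟨q₀, hq₀, q, hq, r ++ [1], by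
          simpa using hx.reaches (r ++ [1]), fun y hy => by
            rcases List.mem_append.1 hy with h | h
            · exact hτ y h
            · rw [List.mem_singleton.1 h]; exact hb⟩
        rw [he, List.append_assoc, ← List.replicate_succ',
          replicate_append_mem_langAB_iff] at hacc'
        omega
    · obtain ⟨p, h1, h2⟩ := NFAwntl.Path.split hx
      exact ⟨p, q₀, hq₀, h1, .inr ⟨q, hq, t, r, hr', h2, hτ⟩⟩
  choose p q₀ hq₀ hpath hrest using key
  obtain ⟨n, m, hnm, h⟩ := Finite.exists_ne_map_eq_of_infinite p
  -- The run on `aⁿ` followed by the rest of the run on `aᵐbᵐ` accepts `aⁿbᵐ`. For exponent `0` no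
  -- such rest is recorded, so the nonzero one of two distinct exponents takes the role of `m`.
  have main : ∀ {n m : ℕ}, p n = p m → m ≠ 0 → n = m := by
    intro n m h hm
    obtain ⟨q, hq, x, r, he, hx, hτ⟩ := (hrest m).resolve_left hm
    rw [← replicate_append_mem_langAB_iff, ← hM]
    refine ⟨q₀ n, hq₀ n, q, hq, r, ((hpath n).reaches _).trans ?_, hτ⟩
    rw [h, he]
    exact hx.reaches r
  by_cases hm : m = 0
  · exact hnm (main h.symm (by omega)).symm
  · exact hnm (main h hm)

theorem not_exists_regular_letterEquivalent_langAB :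
    ¬ ∃ R : Language (Fin 2), R ≤ langAB ∧ R.IsRegular ∧ LetterEquivalent R langAB := by
  rintro ⟨R, hR, hreg, -, hequiv⟩
  have : R = langAB := by
    refine le_antisymm hR ?_
    rintro w ⟨n, rfl⟩
    obtain ⟨y, hy, hp⟩ := hequiv _ ⟨n, rfl⟩
    exact eq_of_perm_of_mem_langAB (hR hy) hp ▸ hy
  exact not_nfaWNTL_langAB (this ▸ hreg).dfaWNTL.nfaWNTL

/-! ### The language `{aⁿbⁿ}` is deterministic linear, linear and in 2detLIN -/

theorem cons_append_mem_langAB {w : List (Fin 2)} (hw : w ∈ langAB) : 0 :: (w ++ [1]) ∈ langAB := by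
  obtain ⟨n, rfl⟩ := hw
  refine ⟨n + 1, ?_⟩
  rw [List.append_assoc, ← List.replicate_succ']
  rfl

theorem replicate_succ_append_replicate_succ (n : ℕ) :
    List.replicate (n + 1) (0 : Fin 2) ++ List.replicate (n + 1) 1 =
      [0] ++ (List.replicate n 0 ++ List.replicate n 1) ++ [1] := by
  rw [List.replicate_succ' (n := n) (a := (1 : Fin 2))]
  simp [List.replicate_succ]

/-- The two-head automaton that reads one `a` from the left and one `b` from the right. -/
def twoHeadAB : TwoHeadFA (Fin 2) Unit where
  trans := {((), [0], [1], ())}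
  start := ()
  accept := Set.univ

theorem twoHeadAB_accepts : twoHeadAB.accepts = langAB := by
  ext w
  constructor
  · rintro ⟨f, -, h⟩
    generalize hc : (twoHeadAB.start, w) = c at h
    induction h using Relation.ReflTransGen.head_induction_on generalizing w with
    | refl => cases hc; exact ⟨0, rfl⟩
    | head h _ ih =>
      subst hc
      cases h with
      | @read _ p u v w h =>
        simp only [twoHeadAB, Finset.mem_singleton, Prod.mk.injEq] at h
        obtain ⟨-, rfl, rfl, -⟩ := h
        exact cons_append_mem_langAB (ih w rfl)
  · rintro ⟨n, rfl⟩
    refine ⟨(), trivial, ?_⟩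
    induction n with
    | zero => exact .refl
    | succ n ih =>
      rw [replicate_succ_append_replicate_succ]
      exact .head (.read (by simp [twoHeadAB])) ih

theorem twoDetLIN_langAB : LanguageClass.twoDetLIN (Fin 2) langAB := by
  refine ⟨Unit, inferInstance, twoHeadAB, ?_, twoHeadAB_accepts⟩
  rintro c ⟨_, w₁⟩ ⟨_, w₂⟩ h₁ h₂
  cases h₁ with
  | @read _ p u v w h =>
    generalize hc : (_, u ++ w₁ ++ v) = c at h₂
    cases h₂ with
    | @read _ p' u' v' w' h' =>
      simp only [twoHeadAB, Finset.mem_singleton, Prod.mk.injEq] at h h'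
      obtain ⟨-, rfl, rfl, -⟩ := h
      obtain ⟨-, rfl, rfl, -⟩ := h'
      simpa using hc

/-- The grammar with the rules `S → aSb` and `S → λ`. -/
abbrev grammarAB : ContextFreeGrammar (Fin 2) where
  NT := Unit
  initial := ()
  rules := {⟨(), [.terminal 0, .nonterminal (), .terminal 1]⟩, ⟨(), []⟩}

theorem grammarAB_isLinear : grammarAB.IsLinear := by
  intro r hr
  simp only [grammarAB, Finset.mem_insert, Finset.mem_singleton] at hr
  rcases hr with rfl | rfl
  · exact .inr ⟨[0], [1], (), rfl⟩
  · exact .inl ⟨[], rfl⟩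

theorem derives_grammarAB (n : ℕ) :
    grammarAB.Derives [.nonterminal ()] (List.replicate n (.terminal 0) ++
      [.nonterminal ()] ++ List.replicate n (.terminal 1)) := by
  induction n with
  | zero => exact .refl _
  | succ n ih =>
    refine ih.trans_produces ⟨⟨(), [.terminal 0, .nonterminal (), .terminal 1]⟩,
      by simp [grammarAB], ?_⟩
    convert ContextFreeRule.rewrites_of_exists_parts _ _ _ using 1
    rw [List.replicate_succ' (a := Symbol.terminal (0 : Fin 2))]
    simp [List.replicate_succ]

theorem eq_of_derives_grammarAB {s : List (Symbol (Fin 2) Unit)}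
    (h : grammarAB.Derives [.nonterminal ()] s) :
    ∃ n, s = List.replicate n (.terminal 0) ++ [.nonterminal ()] ++
        List.replicate n (.terminal 1) ∨
      s = List.replicate n (.terminal 0) ++ List.replicate n (.terminal 1) := by
  induction h with
  | refl => exact ⟨0, .inl rfl⟩
  | tail _ h ih =>
    obtain ⟨r, hr, h⟩ := h
    obtain ⟨p, q, he, rfl⟩ := h.exists_parts
    obtain ⟨n, hn | hn⟩ := ih
    · rw [he] at hn
      -- The sentential form has a single nonterminal. Any other alignment would put it inside a
      -- block of terminals.
      have hpq : p = List.replicate n (.terminal 0) ∧ q = List.replicate n (.terminal 1) := by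
        rw [List.append_assoc, List.append_assoc] at hn
        rcases List.append_eq_append_iff.1 hn with ⟨t, h1, h2⟩ | ⟨t, h1, h2⟩
        · cases t with
          | nil => simp at h1 h2; exact ⟨h1.symm, h2⟩
          | cons y t =>
            have : Symbol.nonterminal () ∈
                List.replicate n (Symbol.terminal (N := Unit) (0 : Fin 2)) := by
              rw [h1]; simp at h2; simp [h2.1]
            simp [List.mem_replicate] at this
        · cases t with
          | nil => simp at h1 h2; exact ⟨h1, h2.symm⟩
          | cons y t =>
            have : Symbol.nonterminal () ∈
                List.replicate n (Symbol.terminal (N := Unit) (1 : Fin 2)) := by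
              simp at h2; rw [h2.2]; simp
            simp [List.mem_replicate] at this
      obtain ⟨rfl, rfl⟩ := hpq
      simp only [grammarAB, Finset.mem_insert, Finset.mem_singleton] at hr
      rcases hr with rfl | rfl
      · refine ⟨n + 1, .inl ?_⟩
        rw [List.replicate_succ' (a := Symbol.terminal (0 : Fin 2))]
        simp [List.replicate_succ]
      · exact ⟨n, .inr (by simp)⟩
    · rw [he] at hn
      have : Symbol.nonterminal r.input ∈ p ++ [Symbol.nonterminal r.input] ++ q := by simp
      rw [hn] at this
      simp [List.mem_replicate] at this

theorem grammarAB_language : grammarAB.language = langAB := by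
  ext w
  rw [ContextFreeGrammar.mem_language_iff]
  constructor
  · intro h
    obtain ⟨n, hn | hn⟩ := eq_of_derives_grammarAB h
    · have : Symbol.nonterminal () ∈ w.map (Symbol.terminal (N := Unit)) := by rw [hn]; simp
      simp at this
    · refine ⟨n, List.map_injective_iff.2 (fun a b hab => Symbol.terminal.inj hab)
        (hn.trans ?_)⟩
      simp
  · rintro ⟨n, rfl⟩
    refine (derives_grammarAB n).trans_produces ⟨⟨(), []⟩, by simp [grammarAB], ?_⟩
    convert ContextFreeRule.rewrites_of_exists_parts _ _ _ using 1
    simp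

theorem linear_langAB : LanguageClass.linear (Fin 2) langAB :=
  ⟨grammarAB, grammarAB_isLinear, grammarAB_language⟩

/-- The pushdown automaton for `{aⁿbⁿ}`. The stack symbol `false` is the bottom symbol. In state `0`
nothing has been read, in state `1` letters `a` are pushed, in state `2` they are compared with
letters `b`, and state `3` is entered when the bottom of the stack is found again. -/
def pdaAB : DetPDA (Fin 2) (Fin 4) Bool where
  step
    | 0, some 0, false => some (1, [true, false])
    | 1, some 0, true => some (1, [true, true])
    | 1, some 1, true => some (2, [])
    | 2, some 1, true => some (2, [])
    | 2, none, false => some (3, [false])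
    | _, _, _ => none
  start := 0
  bottom := false
  accept := {0, 3}
  det := by decide

theorem pdaAB_move {c c' : Fin 4 × List (Fin 2) × List Bool} (h : pdaAB.Move c c') :
    ∃ w s, (c = (0, 0 :: w, false :: s) ∧ c' = (1, w, true :: false :: s)) ∨
      (c = (1, 0 :: w, true :: s) ∧ c' = (1, w, true :: true :: s)) ∨
      (c = (1, 1 :: w, true :: s) ∧ c' = (2, w, s)) ∨
      (c = (2, 1 :: w, true :: s) ∧ c' = (2, w, s)) ∨
      (c = (2, w, false :: s) ∧ c' = (3, w, false :: s)) := by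
  cases h with
  | @read q p a w Z γ s h =>
    refine ⟨w, s, ?_⟩
    simp only [pdaAB] at h
    split at h <;> simp_all [eq_comm (b := γ)]
  | @empty q p w Z γ s h =>
    refine ⟨w, s, ?_⟩
    simp only [pdaAB] at h
    split at h <;> simp_all [eq_comm (b := γ)]

/-- Every popping move enters state `2`. States `2` and `3` are never left again, and no move from
them pushes. -/
theorem pdaAB_isOneTurn : pdaAB.IsOneTurn := by
  intro w c₁ c₂ c₃ c₄ _ h₁₂ hlt h₂₃ h₃₄
  have h₂ : c₂.1 = 2 ∨ c₂.1 = 3 := by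
    obtain ⟨w, s, ⟨rfl, rfl⟩ | ⟨rfl, rfl⟩ | ⟨rfl, rfl⟩ | ⟨rfl, rfl⟩ | ⟨rfl, rfl⟩⟩ :=
      pdaAB_move h₁₂ <;> simp at hlt ⊢
  have h₃ : c₃.1 = 2 ∨ c₃.1 = 3 := by
    clear h₃₄
    induction h₂₃ with
    | refl => exact h₂
    | tail _ h ih =>
      obtain ⟨w, s, ⟨rfl, rfl⟩ | ⟨rfl, rfl⟩ | ⟨rfl, rfl⟩ | ⟨rfl, rfl⟩ | ⟨rfl, rfl⟩⟩ :=
        pdaAB_move h <;> simp_all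
  obtain ⟨w, s, ⟨rfl, rfl⟩ | ⟨rfl, rfl⟩ | ⟨rfl, rfl⟩ | ⟨rfl, rfl⟩ | ⟨rfl, rfl⟩⟩ :=
    pdaAB_move h₃₄ <;> simp at h₃ ⊢

/-- The height of the stack above the bottom symbol records the surplus of `a` over `b` in the input
read so far, so state `3` certifies equality. -/
theorem pdaAB_invariant {w : List (Fin 2)} {c : Fin 4 × List (Fin 2) × List Bool}
    (h : pdaAB.Reaches (0, w, [false]) c) :
    c = (0, w, [false]) ∨ ∃ n k w',
      (c = (1, w', List.replicate n true ++ [false]) ∧ w = List.replicate n 0 ++ w') ∨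
      (c = (2, w', List.replicate k true ++ [false]) ∧
        w = List.replicate (n + k) 0 ++ (List.replicate n 1 ++ w')) ∨
      (c = (3, w', [false]) ∧ w = List.replicate n 0 ++ (List.replicate n 1 ++ w')) := by
  have shift : ∀ (n : ℕ) (a : Fin 2) (v : List (Fin 2)),
      List.replicate (n + 1) a ++ v = List.replicate n a ++ a :: v := by
    intro n a v
    simp [List.replicate_succ']
  induction h with
  | refl => exact .inl rfl
  | tail _ h ih =>
    right
    obtain ⟨v, s, ⟨rfl, rfl⟩ | ⟨rfl, rfl⟩ | ⟨rfl, rfl⟩ | ⟨rfl, rfl⟩ | ⟨rfl, rfl⟩⟩ :=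
      pdaAB_move h
    · obtain ⟨rfl, rfl⟩ : 0 :: v = w ∧ s = [] := by simpa using ih
      exact ⟨1, 0, v, .inl ⟨rfl, rfl⟩⟩
    · obtain ⟨n, hs, rfl⟩ : ∃ n, true :: s = List.replicate n true ++ [false] ∧
          w = List.replicate n 0 ++ 0 :: v := by simpa using ih
      exact ⟨n + 1, 0, v, .inl ⟨by rw [hs]; rfl, (shift _ _ _).symm⟩⟩
    · obtain ⟨n, hs, rfl⟩ : ∃ n, true :: s = List.replicate n true ++ [false] ∧
          w = List.replicate n 0 ++ 1 :: v := by simpa using ih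
      cases n with
      | zero => simp at hs
      | succ n =>
        refine ⟨1, n, v, .inr (.inl ⟨?_, ?_⟩)⟩
        · simpa [List.replicate_succ] using hs
        · rw [Nat.add_comm]; rfl
    · obtain ⟨n, k, hs, rfl⟩ : ∃ n k, true :: s = List.replicate k true ++ [false] ∧
          w = List.replicate (n + k) 0 ++ (List.replicate n 1 ++ 1 :: v) := by simpa using ih
      cases k with
      | zero => simp at hs
      | succ k =>
        refine ⟨n + 1, k, v, .inr (.inl ⟨?_, ?_⟩)⟩
        · simpa [List.replicate_succ] using hs
        · rw [shift, Nat.add_right_comm]; rfl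
    · obtain ⟨n, k, hs, rfl⟩ : ∃ n k, false :: s = List.replicate k true ++ [false] ∧
          w = List.replicate (n + k) 0 ++ (List.replicate n 1 ++ v) := by simpa using ih
      cases k with
      | zero => exact ⟨n, 0, v, .inr (.inr ⟨by simpa using hs, rfl⟩)⟩
      | succ k => simp [List.replicate_succ] at hs

theorem pdaAB_reaches_push (n : ℕ) (v : List (Fin 2)) (s : List Bool) :
    pdaAB.Reaches (1, List.replicate n 0 ++ v, true :: s)
      (1, v, true :: (List.replicate n true ++ s)) := by
  induction n generalizing s with
  | zero => exact .refl
  | succ n ih =>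
    have := ih (true :: s)
    rw [← List.singleton_append (l := s), ← List.append_assoc, ← List.replicate_succ'] at this
    exact .head (.read rfl) this

theorem pdaAB_reaches_pop (n : ℕ) (s : List Bool) :
    pdaAB.Reaches (2, List.replicate n 1, List.replicate n true ++ s) (2, [], s) := by
  induction n with
  | zero => exact .refl
  | succ n ih => exact .head (DetPDA.Move.read (M := pdaAB) (γ := []) rfl) ih

theorem pdaAB_accepts : pdaAB.accepts = langAB := by
  ext w
  constructor
  · rintro ⟨f, hf, s, h⟩
    rcases pdaAB_invariant h with he | ⟨n, k, w', ⟨he, -⟩ | ⟨he, -⟩ | ⟨he, rfl⟩⟩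
    · cases he
      exact ⟨0, rfl⟩
    · cases he
      simp [pdaAB] at hf
    · cases he
      simp [pdaAB] at hf
    · cases he
      exact ⟨n, by simp⟩
  · rintro ⟨n, rfl⟩
    cases n with
    | zero => exact ⟨0, .inl rfl, [false], .refl⟩
    | succ n =>
      refine ⟨3, .inr rfl, [false], .head (.read rfl) ((pdaAB_reaches_push n _ [false]).trans ?_)⟩
      refine .head (DetPDA.Move.read (M := pdaAB) (γ := []) rfl) ?_
      exact (pdaAB_reaches_pop n [false]).tail
        (DetPDA.Move.empty (M := pdaAB) (γ := [false]) (s := []) rfl)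

theorem detLinear_langAB : LanguageClass.detLinear (Fin 2) langAB :=
  ⟨Fin 4, Bool, inferInstance, inferInstance, pdaAB, pdaAB_isOneTurn, pdaAB_accepts⟩

/-! ### Inclusions between the classes and the separation argument -/

theorem LanguageClass.detLinear.detContextFree {α : Type} {L : Language α}
    (h : LanguageClass.detLinear α L) : LanguageClass.detContextFree α L := by
  obtain ⟨σ, Γ, hσ, hΓ, M, -, hM⟩ := h
  exact ⟨σ, Γ, hσ, hΓ, M, hM⟩

theorem LanguageClass.linear.isContextFree {α : Type} {L : Language α}
    (h : LanguageClass.linear α L) : L.IsContextFree := by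
  obtain ⟨g, -, hg⟩ := h
  exact ⟨g, hg⟩

/-- Any class between DFAwntl and NFAwntl contains the cyclic language and omits `langAB`, so both
translucent classes are treated at once. -/
theorem LanguageClass.incomparable_of_langAB_of_cyclicAutomaton {C D : LanguageClass}
    (hC : C.Included LanguageClass.nfaWNTL) (hC' : LanguageClass.dfaWNTL.Included C)
    (hD : D (Fin 2) langAB) (hD' : ∀ L, D (Fin 4) L → BinaryGenerated L) : C.Incomparable D :=
  ⟨fun h => not_binaryGenerated_cyclicAutomaton
      (hD' _ (h _ _ (hC' _ _ cyclicAutomaton_dfaWNTL))),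
    fun h => not_nfaWNTL_langAB (hC _ _ (h _ _ hD))⟩

theorem mainTheorem1 :
    -- both classes properly include the regular languages
    LanguageClass.regular.ProperlyIncluded LanguageClass.nfaWNTL ∧
    LanguageClass.regular.ProperlyIncluded LanguageClass.dfaWNTL ∧
    -- both classes are incomparable with each of the five classes
    (∀ C ∈ ({LanguageClass.nfaWNTL, LanguageClass.dfaWNTL} : Set LanguageClass),
      ∀ D ∈ ({LanguageClass.detLinear, LanguageClass.twoDetLIN, LanguageClass.linear,
          LanguageClass.detContextFree, LanguageClass.contextFree} : Set LanguageClass),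
        C.Incomparable D) ∧
    -- a language of a DFAwntl that is not context-free
    (∃ L : Language (Fin 4), LanguageClass.dfaWNTL (Fin 4) L ∧
      L ⊓ langBlocks = langADCB ∧ ¬ langADCB.IsContextFree ∧ ¬ L.IsContextFree) ∧
    -- `{aⁿbⁿ}` is in the five classes, but is not accepted by any NFAwntl
    (LanguageClass.detLinear (Fin 2) langAB ∧ LanguageClass.twoDetLIN (Fin 2) langAB ∧
      LanguageClass.linear (Fin 2) langAB ∧ LanguageClass.detContextFree (Fin 2) langAB ∧
      LanguageClass.contextFree (Fin 2) langAB ∧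
      (¬ ∃ R : Language (Fin 2), R ≤ langAB ∧ R.IsRegular ∧ LetterEquivalent R langAB) ∧
      ¬ LanguageClass.nfaWNTL (Fin 2) langAB) := by
  have hreg : ¬ cyclicAutomaton.accepts.IsRegular :=
    not_isRegular_of_langADCB_le langADCB_le_cyclicAutomaton
      fun _ => count_eq_of_mem_cyclicAutomaton
  refine ⟨⟨fun α _ L h => Language.IsRegular.dfaWNTL h |>.nfaWNTL,
      fun h => hreg (h _ _ cyclicAutomaton_dfaWNTL.nfaWNTL)⟩,
    ⟨fun α _ L h => Language.IsRegular.dfaWNTL h,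
      fun h => hreg (h _ _ cyclicAutomaton_dfaWNTL)⟩,
    ?_,
    ⟨cyclicAutomaton.accepts, cyclicAutomaton_dfaWNTL, cyclicAutomaton_inf_langBlocks,
      not_isContextFree_langADCB,
      fun h => not_binaryGenerated_cyclicAutomaton h.binaryGenerated⟩,
    detLinear_langAB, twoDetLIN_langAB, linear_langAB, detLinear_langAB.detContextFree,
    linear_langAB.isContextFree, not_exists_regular_letterEquivalent_langAB, not_nfaWNTL_langAB⟩
  intro C hC D hD
  have hC₁ : C.Included LanguageClass.nfaWNTL ∧ LanguageClass.dfaWNTL.Included C := by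
    rcases hC with rfl | rfl
    · exact ⟨fun _ _ _ h => h, fun _ _ _ h => h.nfaWNTL⟩
    · exact ⟨fun _ _ _ h => h.nfaWNTL, fun _ _ _ h => h⟩
  have hD₁ : D (Fin 2) langAB ∧ ∀ L, D (Fin 4) L → BinaryGenerated L := by
    rcases hD with rfl | rfl | rfl | rfl | rfl
    · exact ⟨detLinear_langAB, fun _ h => h.detContextFree.binaryGenerated⟩
    · exact ⟨twoDetLIN_langAB, fun _ h => h.binaryGenerated⟩
    · exact ⟨linear_langAB, fun _ h => h.isContextFree.binaryGenerated⟩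
    · exact ⟨detLinear_langAB.detContextFree, fun _ h => h.binaryGenerated⟩
    · exact ⟨linear_langAB.isContextFree, fun _ h => Language.IsContextFree.binaryGenerated h⟩
  exact LanguageClass.incomparable_of_langAB_of_cyclicAutomaton hC₁.1 hC₁.2 hD₁.1 hD₁.2
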